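/- Let $\Lambda$ be a left and right noetherian ring and $k$ a positive integer. Write $\operatorname{mod}\Lambda$ for the category of finitely generated left $\Lambda$-modules and $\mathcal P^{n}(\Lambda)$ for its full subcategory of modules of projective dimension at most $n$. Conventions. For $M\in\operatorname{mod}\Lambda$, the group $\operatorname{Ext}^i_\Lambda(M,\Lambda)$ is a right $\Lambda$-module via right multiplication on $\Lambda$. A right $\Lambda$-module $X$ has grade at least $i$ if $\operatorname{Ext}^j_{\Lambda^{op}}(X,\Lambda)=0$ for $0\le j<i$; a right module $N$ satisfies $\operatorname{s.grade}N\ge i$ if every submodule of $N$ has grade at least $i$. The ring $\Lambda$ has property $(\mathrm W^{n})$ if every $M\in\operatorname{mod}\Lambda$ with $\operatorname{Ext}^i_\Lambda(M,\Lambda)=0$ for $1\le i\le n$ is torsionless, i.e. the evaluation map $M\to M^{**}$ is injective, where $(-)^*=\operatorname{Hom}(-,\Lambda)$. The ring $\Lambda$ is right quasi $k$-Gorenstein if, in a minimal injective resolution $0\to\Lambda\to I_0\to I_1\to\cdots$ of $\Lambda$ as a right $\Lambda$-module, the flat dimension of $I_i$ is at most $i+1$ for $0\le i\le k-1$. For a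 full subcategory $\mathcal D\subseteq\operatorname{mod}\Lambda$, let $\operatorname{add}\mathcal D$ consist of the modules isomorphic to direct summands of finite direct sums of modules in $\mathcal D$. A left $\mathcal D$-approximation of $M$ is a homomorphism $M\to D$ with $D\in\operatorname{add}\mathcal D$ such that $\operatorname{Hom}_\Lambda(D,X)\to\operatorname{Hom}_\Lambda(M,X)$ is surjective for all $X\in\operatorname{add}\mathcal D$; $\mathcal D$ is covariantly finite in $\operatorname{mod}\Lambda$ if every module in $\operatorname{mod}\Lambda$ has a left $\mathcal D$-approximation. **Proposition 3.7.** Let $M\in\operatorname{mod}\Lambda$ satisfy $\operatorname{s.grade}\operatorname{Ext}^{t+1}_\Lambda(M,\Lambda)\ge t$ for all $1\le t\le k-1$. If $\Lambda$ has property $(\mathrm W^{k})$, then $M$ has a left $\mathcal P^{k}(\Lambda)$-approximation. **Corollary 3.8.** Let $\Lambda$ be right quasi $k$-Gorenstein. 1. If $\Lambda$ has property $(\mathrm W^{k})$, then $\mathcal P^{k}(\Lambda)$ is covariantly finite in $\operatorname{mod}\Lambda$. 2. If $\Lambda$ has property $(\mathrm W^{k+1})$, then $\mathcal P^{k+1}(\Lambda)$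 is covariantly finite in $\operatorname{mod}\Lambda$. -/

import Mathlib

open CategoryTheory MulOpposite
open scoped TensorProduct

universe u

noncomputable section

namespace HomologicalFiniteness

/-! Left `Λ`-modules are objects of `ModuleCat Λ`; right `Λ`-modules are objects of
`ModuleCat Λᵐᵒᵖ`. The right module `Λ` is `Λ` with `op r • x = x * r`. -/

section LeftModules

variable (Λ : Type u) [Ring Λ]

/-- `mod Λ`: the finitely generated left `Λ`-modules. -/
def finMod : ObjectProperty (ModuleCat.{u} Λ) := fun M => Module.Finite Λ M

/-- `𝒫ᵏ(Λ)`: the finitely generated left `Λ`-modules of projective dimension at most `k`. -/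
def projDimLE (k : ℕ) : ObjectProperty (ModuleCat.{u} Λ) := fun M =>
  Module.Finite Λ M ∧ HasProjectiveDimensionLE M k

variable {Λ}

/-- Right multiplication by `r`, as an endomorphism of the left module `Λ`. -/
def rightMul (r : Λ) : ModuleCat.of Λ Λ ⟶ ModuleCat.of Λ Λ :=
  ModuleCat.ofHom (LinearMap.toSpanSingleton Λ Λ r)

/-- The right `Λ`-module structure on `Extⁱ_Λ(M, Λ)`: `r` acts by functoriality in the second
variable, through right multiplication by `r` on `Λ`. -/
abbrev extModule (M : ModuleCat.{u} Λ) (i : ℕ) :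
    Module Λᵐᵒᵖ (Abelian.Ext.{u} M (ModuleCat.of Λ Λ) i) where
  smul r x := x.comp (Abelian.Ext.mk₀ (rightMul r.unop)) (add_zero i)
  one_smul x := by
    change x.comp (Abelian.Ext.mk₀ (rightMul (1 : Λ))) (add_zero i) = x
    have h : rightMul (1 : Λ) = 𝟙 _ := by
      ext
      simp [rightMul]
    rw [h]
    exact Abelian.Ext.comp_mk₀_id x
  mul_smul r s x := by
    change x.comp (Abelian.Ext.mk₀ (rightMul (r * s).unop)) (add_zero i) =
      (x.comp (Abelian.Ext.mk₀ (rightMul s.unop)) (add_zero i)).comp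
        (Abelian.Ext.mk₀ (rightMul r.unop)) (add_zero i)
    have h : rightMul (r * s).unop = rightMul s.unop ≫ rightMul r.unop := by
      ext
      simp [rightMul]
    rw [h, Abelian.Ext.comp_assoc_of_third_deg_zero, Abelian.Ext.mk₀_comp_mk₀]
  smul_zero r := Abelian.Ext.zero_comp M i _ i (add_zero i)
  smul_add r x y := Abelian.Ext.add_comp _ _ _ (add_zero i)
  zero_smul x := by
    change x.comp (Abelian.Ext.mk₀ (rightMul (0 : Λ))) (add_zero i) = 0
    have h : rightMul (0 : Λ) = 0 := by
      ext
      simp [rightMul]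
    rw [h, Abelian.Ext.mk₀_zero, Abelian.Ext.comp_zero]
  add_smul r s x := by
    change x.comp (Abelian.Ext.mk₀ (rightMul (r + s).unop)) (add_zero i) =
      x.comp (Abelian.Ext.mk₀ (rightMul r.unop)) (add_zero i) +
      x.comp (Abelian.Ext.mk₀ (rightMul s.unop)) (add_zero i)
    have h : rightMul (r + s).unop = rightMul r.unop + rightMul s.unop := by
      ext
      simp [rightMul]
    rw [h, Abelian.Ext.mk₀_add, Abelian.Ext.comp_add]

/-- `Extⁱ_Λ(M, Λ)`, as a type of its own that carries the right `Λ`-module structure. -/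
def ExtRing (M : ModuleCat.{u} Λ) (i : ℕ) : Type u :=
  Abelian.Ext.{u} M (ModuleCat.of Λ Λ) i

instance (M : ModuleCat.{u} Λ) (i : ℕ) : AddCommGroup (ExtRing M i) :=
  inferInstanceAs (AddCommGroup (Abelian.Ext.{u} M (ModuleCat.of Λ Λ) i))

instance (M : ModuleCat.{u} Λ) (i : ℕ) : Module Λᵐᵒᵖ (ExtRing M i) :=
  extModule M i

/-- `M` is a `Wᵏ`-module: `Extⁱ_Λ(M, Λ) = 0` for `1 ≤ i ≤ k`. -/
def IsWModule (k : ℕ) (M : ModuleCat.{u} Λ) : Prop :=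
  ∀ i : ℕ, 1 ≤ i → i ≤ k → Subsingleton (ExtRing M i)

/-- The evaluation map `σ_A : A → A**`, `σ_A(x)(f) = f(x)`, where `A* = Hom_Λ(A, Λ)` is a right
`Λ`-module through the right multiplication of `Λ`. -/
def evalBidual (A : ModuleCat.{u} Λ) : A →ₗ[Λ] ((A →ₗ[Λ] Λ) →ₗ[Λᵐᵒᵖ] Λ) where
  toFun x :=
    { toFun := fun f => f x
      map_add' := fun _ _ => rfl
      map_smul' := fun _ _ => rfl }
  map_add' x y := by
    ext f
    exact f.map_add x y
  map_smul' r x := by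
    ext f
    exact f.map_smul r x

/-- `A` is torsionless: `σ_A` is a monomorphism. -/
def IsTorsionless (A : ModuleCat.{u} Λ) : Prop := Function.Injective (evalBidual A)

variable (Λ) in
/-- Property `(Wᵏ)`: each `Wᵏ`-module in `mod Λ` is torsionless. -/
def HasPropertyW (k : ℕ) : Prop :=
  ∀ M : ModuleCat.{u} Λ, finMod Λ M → IsWModule k M → IsTorsionless M

/-- `add 𝒟`: the modules isomorphic to direct summands of finite direct sums of modules
in `𝒟`. -/
def addClosure (D : ObjectProperty (ModuleCat.{u} Λ)) : ObjectProperty (ModuleCat.{u} Λ) :=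
  fun X => ∃ (Z : ModuleCat.{u} Λ) (n : ℕ) (Y : Fin n → ModuleCat.{u} Λ),
    (∀ i, D (Y i)) ∧ Nonempty ((X × Z) ≃ₗ[Λ] (∀ i, Y i))

/-- `f : M → F` is a left `𝒟`-approximation of `M`: `F ∈ add 𝒟`, and
`Hom(F, X) → Hom(M, X) → 0` is exact for all `X ∈ add 𝒟`. -/
def IsLeftApproximation (D : ObjectProperty (ModuleCat.{u} Λ)) {M F : ModuleCat.{u} Λ}
    (f : M ⟶ F) : Prop :=
  addClosure D F ∧ ∀ X : ModuleCat.{u} Λ, addClosure D X →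
    Function.Surjective (fun h : F ⟶ X => f ≫ h)

/-- `M` has a left `𝒟`-approximation. -/
def HasLeftApproximation (D : ObjectProperty (ModuleCat.{u} Λ)) (M : ModuleCat.{u} Λ) : Prop :=
  ∃ (F : ModuleCat.{u} Λ) (f : M ⟶ F), IsLeftApproximation D f

/-- The full subcategory `𝒟` of `𝒞` is covariantly finite in `𝒞`. -/
def IsCovariantlyFinite (D C : ObjectProperty (ModuleCat.{u} Λ)) : Prop :=
  D ≤ C ∧ ∀ M : ModuleCat.{u} Λ, C M → HasLeftApproximation D M

end LeftModules

section RightModules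

variable {Λ : Type u} [Ring Λ]

/-- The grade of the right module `N` is at least `i`: `Extʲ(N, Λ) = 0` for `0 ≤ j < i`. -/
def GradeGE (i : ℕ) (N : ModuleCat.{u} Λᵐᵒᵖ) : Prop :=
  ∀ j : ℕ, j < i → Subsingleton (Abelian.Ext.{u} N (ModuleCat.of Λᵐᵒᵖ Λ) j)

/-- The strong grade of the right module `N` is at least `i`: every submodule has grade at
least `i`. -/
def StrongGradeGE (i : ℕ) (N : ModuleCat.{u} Λᵐᵒᵖ) : Prop :=
  ∀ X : Submodule Λᵐᵒᵖ N, GradeGE i (ModuleCat.of Λᵐᵒᵖ X)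

/-- The relations `n r ⊗ m = n ⊗ r m` in `N ⊗_ℤ M`, for a right module `N` and a left
module `M`. -/
def tensorRel (N : ModuleCat.{u} Λᵐᵒᵖ) (M : ModuleCat.{u} Λ) : AddSubgroup (N ⊗[ℤ] M) :=
  AddSubgroup.closure
    {x | ∃ (n : N) (r : Λ) (m : M), x = (op r • n) ⊗ₜ[ℤ] m - n ⊗ₜ[ℤ] (r • m)}

/-- The map `N ⊗_Λ M → N ⊗_Λ M'` induced by `f : M → M'`, where `N ⊗_Λ M` is the quotient of
`N ⊗_ℤ M` by the relations `n r ⊗ m = n ⊗ r m`. -/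
def tensorMap (N : ModuleCat.{u} Λᵐᵒᵖ) {M M' : ModuleCat.{u} Λ} (f : M →ₗ[Λ] M') :
    ((N ⊗[ℤ] M) ⧸ tensorRel N M) →+ ((N ⊗[ℤ] M') ⧸ tensorRel N M') :=
  QuotientAddGroup.map _ _ (LinearMap.lTensor N (f.restrictScalars ℤ)).toAddMonoidHom (by
    refine (AddSubgroup.closure_le _).2 ?_
    rintro _ ⟨n, r, m, rfl⟩
    refine AddSubgroup.subset_closure ⟨n, r, f m, ?_⟩
    rw [map_sub]
    simp)

/-- The right `Λ`-module `N` is flat: `N ⊗_Λ -` preserves injections of left modules. -/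
def IsFlatRight (N : ModuleCat.{u} Λᵐᵒᵖ) : Prop :=
  ∀ (M M' : ModuleCat.{u} Λ) (f : M →ₗ[Λ] M'), Function.Injective f →
    Function.Injective (tensorMap N f)

/-- The right `Λ`-module `N` has flat dimension at most `n`: there is an exact sequence
`0 → Fₙ → ⋯ → F₀ → N → 0` with all `Fᵢ` flat (built from its short exact pieces). -/
def FlatDimLE : ℕ → ModuleCat.{u} Λᵐᵒᵖ → Prop
  | 0, N => IsFlatRight N
  | n + 1, N => ∃ (K F : ModuleCat.{u} Λᵐᵒᵖ) (i : K →ₗ[Λᵐᵒᵖ] F) (p : F →ₗ[Λᵐᵒᵖ] N),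
      Function.Injective i ∧ Function.Exact i p ∧ Function.Surjective p ∧
      IsFlatRight F ∧ FlatDimLE n K

/-- The injective resolution `0 → N → I₀ → I₁ → ⋯` is minimal: for every `n`, the submodule
`Ker(Iₙ → Iₙ₊₁)` (the `n`-th cosyzygy; for `n = 0` it is the image of `N`) is essential in `Iₙ`,
so that `Iₙ` is its injective envelope. -/
def IsMinimalResolution {N : ModuleCat.{u} Λᵐᵒᵖ} (I : InjectiveResolution N) : Prop :=
  ∀ (n : ℕ) (X : Submodule Λᵐᵒᵖ (I.cocomplex.X n)),
    X ⊓ LinearMap.ker (I.cocomplex.d n (n + 1)).hom = ⊥ → X = ⊥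

variable (Λ) in
/-- `Λ` is right quasi `k`-Gorenstein: in the minimal injective resolution
`0 → Λ → I₀ → I₁ → ⋯` of the right module `Λ` (unique up to isomorphism), the flat dimension of
`Iᵢ` is at most `i + 1` for `0 ≤ i ≤ k - 1`. -/
def IsRightQuasiGorenstein (k : ℕ) : Prop :=
  ∃ I : InjectiveResolution (ModuleCat.of Λᵐᵒᵖ Λ), IsMinimalResolution I ∧
    ∀ i : ℕ, i < k → FlatDimLE (i + 1) (I.cocomplex.X i)

end RightModules

end HomologicalFiniteness

end

/-!
Put `X₀ = M`. Given a finitely generated `Wⁿ`-module `Xₙ` that maps onto `M` with kernel of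
projective dimension less than `n`, take a resolution of `E = Extⁿ⁺¹(Xₙ, Λ)` by finite free right
modules. If `E` has grade at least `n`, its dual is exact up to degree `n - 1`, so the `n`-th
cokernel `Q` has projective dimension at most `n`. The generators of `E` define a class in
`Ext¹(Xₙ, Q)` such that in the corresponding extension `0 → Q → Xₙ₊₁ → Xₙ → 0` the connecting map
sends `Extⁿ(Q, Λ)` onto `E`; hence `Xₙ₊₁` is a `Wⁿ⁺¹`-module.

By `(Wᵏ)`, `Xₖ` embeds in a finite free module `F` through which every functional factors. Then
`Extⁱ(F / Xₖ, Λ) = 0` for `1 ≤ i ≤ k + 1`, so maps from `Xₖ` to modules in `𝒫ᵏ` extend to `F`, and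
the pushout of `F` along `Xₖ → M` is a left approximation of `M`.

If the injective right module `I` has flat dimension at most `t`, then `Torₜ₊₁(I, M) = 0`, that is,
`Hom(Extᵗ⁺¹(M, Λ), I) = 0`. So the condition on an injective resolution of `Λ` makes the grade of
`Extᵗ⁺¹(M, Λ)` at least `t` for `t ≤ k`, for every `M`.
-/

namespace HomologicalFiniteness

open Abelian Limits

section AbelianCategory

universe w v₁ u₁

variable {C : Type u₁} [Category.{v₁} C] [Abelian C]

section Pushout

variable {S : ShortComplex C} (hS : S.ShortExact)
include hS

lemma shortExact_pushout_X₁ {Q : C} (g : S.X₁ ⟶ Q) :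
    (ShortComplex.mk (pushout.inr S.f g) (pushout.desc S.g 0 (by simp))
      (pushout.inr_desc _ _ _)).ShortExact := by
  have := hS.mono_f
  have := hS.epi_g
  have : Epi (pushout.desc (f := S.f) (g := g) S.g 0 (by simp)) :=
    epi_of_epi_fac (f := pushout.inl S.f g) (pushout.inl_desc _ _ _)
  refine .mk (ShortComplex.exact_of_g_is_cokernel _
    (CokernelCofork.IsColimit.ofπ' _ _ fun k hk => ?_))
  have hk' : S.f ≫ pushout.inl S.f g ≫ k = 0 := by rw [pushout.condition_assoc, hk, comp_zero]
  refine ⟨hS.exact.desc _ hk', pushout.hom_ext ?_ ?_⟩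
  · rw [pushout.inl_desc_assoc, hS.exact.g_desc]
  · rw [pushout.inr_desc_assoc, zero_comp, hk]

lemma shortExact_pushout_X₃ {D : C} (j : S.X₂ ⟶ D) [Mono j] :
    (ShortComplex.mk (S.f ≫ j) (pushout.inl j S.g) (by simp [pushout.condition])).ShortExact := by
  have := hS.mono_f
  have := hS.epi_g
  refine .mk (ShortComplex.exact_of_g_is_cokernel _
    (CokernelCofork.IsColimit.ofπ' _ _ fun k hk => ?_))
  have hk' : S.f ≫ j ≫ k = 0 := (Category.assoc _ _ _).symm.trans hk
  exact ⟨pushout.desc k (hS.exact.desc _ hk') (hS.exact.g_desc _ _).symm, pushout.inl_desc _ _ _⟩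

end Pushout

section Ext

variable [HasExt.{w} C]

lemma exists_shortExact_extClass_eq [EnoughProjectives C] {X Q : C} (ξ : Ext.{w} X Q 1) :
    ∃ (E : C) (i : Q ⟶ E) (p : E ⟶ X) (w : i ≫ p = 0)
      (hS : (ShortComplex.mk i p w).ShortExact), hS.extClass = ξ := by
  let T := ShortComplex.mk _ _ (kernel.condition (Projective.π X))
  have hT : T.ShortExact := { exact := ShortComplex.exact_kernel _ }
  obtain ⟨y, hy⟩ := Ext.contravariant_sequence_exact₃ hT Q ξ
    (Ext.eq_zero_of_projective (P := Projective.over X) _) (add_zero 1)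
  obtain ⟨g, rfl⟩ := (Ext.mk₀_bijective _ _).2 y
  have hS := shortExact_pushout_X₁ hT g
  let φ : T ⟶ ShortComplex.mk (pushout.inr T.f g) (pushout.desc T.g 0 (by simp))
      (pushout.inr_desc _ _ _) :=
    { τ₁ := g
      τ₂ := pushout.inl T.f g
      τ₃ := 𝟙 X
      comm₁₂ := pushout.condition.symm
      comm₂₃ := (pushout.inl_desc _ _ _).trans (Category.comp_id _).symm }
  refine ⟨_, _, _, _, hS, ?_⟩
  rw [← hy, ← Ext.mk₀_id_comp hS.extClass]
  exact (hT.extClass_naturality hS φ).symm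

section Vanishing

variable {S : ShortComplex C} (hS : S.ShortExact)
include hS

lemma subsingleton_ext_X₃ (L : C) (n : ℕ) [Subsingleton (Ext.{w} S.X₁ L n)]
    [Subsingleton (Ext.{w} S.X₂ L (n + 1))] : Subsingleton (Ext.{w} S.X₃ L (n + 1)) := by
  refine subsingleton_of_forall_eq 0 fun x => ?_
  obtain ⟨y, rfl⟩ := Ext.contravariant_sequence_exact₃ hS L x (Subsingleton.elim _ _)
    (add_comm 1 n)
  rw [Subsingleton.elim y 0, Ext.comp_zero]

lemma subsingleton_ext_covariant_X₃ (Y : C) (n : ℕ) [Subsingleton (Ext.{w} Y S.X₂ n)]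
    [Subsingleton (Ext.{w} Y S.X₁ (n + 1))] : Subsingleton (Ext.{w} Y S.X₃ n) := by
  refine subsingleton_of_forall_eq 0 fun x => ?_
  obtain ⟨y, rfl⟩ := Ext.covariant_sequence_exact₃ Y hS x rfl (Subsingleton.elim _ _)
  rw [Subsingleton.elim y 0, Ext.zero_comp]

lemma exists_comp_eq_of_subsingleton_ext_one {Z : C} [Subsingleton (Ext.{w} S.X₃ Z 1)]
    (h : S.X₁ ⟶ Z) : ∃ g : S.X₂ ⟶ Z, S.f ≫ g = h := by
  obtain ⟨y, hy⟩ := Ext.contravariant_sequence_exact₁ hS Z (Ext.mk₀ h) (add_zero 1)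
    (Subsingleton.elim _ _)
  obtain ⟨g, rfl⟩ := (Ext.mk₀_bijective _ _).2 y
  exact ⟨g, (Ext.mk₀_bijective _ _).1 (by rwa [Ext.mk₀_comp_mk₀] at hy)⟩

lemma subsingleton_ext_one_of_forall_exists_comp_eq {L : C} [Projective S.X₂]
    (h : ∀ f : S.X₁ ⟶ L, ∃ g : S.X₂ ⟶ L, S.f ≫ g = f) : Subsingleton (Ext.{w} S.X₃ L 1) := by
  refine subsingleton_of_forall_eq 0 fun x => ?_
  obtain ⟨y, rfl⟩ := Ext.contravariant_sequence_exact₃ hS L x (Ext.eq_zero_of_projective _)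
    (add_zero 1)
  obtain ⟨f, rfl⟩ := (Ext.mk₀_bijective _ _).2 y
  obtain ⟨g, rfl⟩ := h f
  rw [← Ext.mk₀_comp_mk₀]
  exact hS.extClass_comp_assoc _

end Vanishing

/-- The sequence `Extʲ(P, L) ⟶ Extʲ(Q, L) ⟶ Extˢ⁺ʲ(X, L) ⟶ 0`, given by composition with
`ι : Q ⟶ P` and with `ξ ∈ Extˢ(X, Q)`, is an exact complex. -/
structure IsExtPresentation {X Q P : C} {s j N : ℕ} (ξ : Ext.{w} X Q s) (ι : Q ⟶ P) (L : C)
    (h : s + j = N) : Prop where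
  comp_eq_zero : ξ.comp (Ext.mk₀ ι) (add_zero s) = 0
  surjective (z : Ext.{w} X L N) : ∃ y : Ext.{w} Q L j, ξ.comp y h = z
  exact (y : Ext.{w} Q L j) (hy : ξ.comp y h = 0) :
    ∃ g : Ext.{w} P L j, (Ext.mk₀ ι).comp g (zero_add j) = y

lemma IsExtPresentation.exists_succ {S : ShortComplex C} (hS : S.ShortExact) [Projective S.X₂]
    {X L : C} {s j N : ℕ} {ξ : Ext.{w} X S.X₁ (s + 1)} {h : s + 1 + j = N}
    (hξ : IsExtPresentation ξ S.f L h) {P : C} (ι : S.X₃ ⟶ P) [Subsingleton (Ext.{w} X P s)] :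
    ∃ ξ' : Ext.{w} X S.X₃ s, IsExtPresentation ξ' ι L (j := j + 1) (by omega : _ = N) := by
  obtain ⟨ξ', rfl⟩ := Ext.covariant_sequence_exact₁ X hS ξ hξ.comp_eq_zero rfl
  refine ⟨ξ', Subsingleton.elim _ _, fun z => ?_, fun y' hy' => ⟨0, ?_⟩⟩
  · obtain ⟨y, rfl⟩ := hξ.surjective z
    exact ⟨hS.extClass.comp y (add_comm 1 j), (Ext.comp_assoc _ _ _ rfl _ (by omega)).symm⟩
  · obtain ⟨y, rfl⟩ := Ext.contravariant_sequence_exact₃ hS L y' (Ext.eq_zero_of_projective _)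
      (add_comm 1 j)
    obtain ⟨g, rfl⟩ := hξ.exact y ((Ext.comp_assoc _ _ _ rfl _ (by omega)).trans hy')
    rw [Ext.comp_zero, hS.extClass_comp_assoc]

lemma IsExtPresentation.comp_iso {X Q Q' P L : C} {s j N : ℕ} {ξ : Ext.{w} X Q s} (e : Q ≅ Q')
    {ι : Q' ⟶ P} {h : s + j = N} (hξ : IsExtPresentation ξ (e.hom ≫ ι) L h) :
    IsExtPresentation (ξ.comp (Ext.mk₀ e.hom) (add_zero s)) ι L h where
  comp_eq_zero := by
    rw [Ext.comp_assoc_of_third_deg_zero, Ext.mk₀_comp_mk₀, hξ.comp_eq_zero]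
  surjective z := by
    obtain ⟨y, rfl⟩ := hξ.surjective z
    refine ⟨(Ext.mk₀ e.inv).comp y (zero_add j), ?_⟩
    rw [Ext.comp_assoc_of_second_deg_zero, Ext.mk₀_comp_mk₀_assoc, e.hom_inv_id, Ext.mk₀_id_comp]
  exact y hy := by
    rw [Ext.comp_assoc_of_second_deg_zero] at hy
    obtain ⟨g, hg⟩ := hξ.exact _ hy
    refine ⟨g, ?_⟩
    rw [← Ext.mk₀_id_comp y, ← e.inv_hom_id, ← Ext.mk₀_comp_mk₀_assoc, ← hg,
      Ext.mk₀_comp_mk₀_assoc, e.inv_hom_id_assoc]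

end Ext

section Opcycles

variable (K : CochainComplex C ℕ)

variable {K} in
lemma shortExact_opcycles {j : ℕ} (hj : K.ExactAt j) :
    (ShortComplex.mk (K.fromOpcycles j (j + 1)) (K.pOpcycles (j + 1))
      (by rw [← cancel_epi (K.pOpcycles j), K.p_fromOpcycles_assoc, K.d_pOpcycles,
        comp_zero])).ShortExact := by
  have : Mono (K.fromOpcycles j (j + 1)) :=
    Preadditive.mono_of_isZero_kernel' _ (K.homologyIsKernel j (j + 1) (by simp)) hj.isZero_homology
  refine .mk (ShortComplex.exact_of_g_is_cokernel _
    (CokernelCofork.IsColimit.ofπ' _ _ fun k hk => ?_))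
  have hk' : K.d j (j + 1) ≫ k = 0 := by
    rw [← K.p_fromOpcycles, Category.assoc, hk, comp_zero]
  exact ⟨K.descOpcycles k j (by simp) hk', K.p_descOpcycles _ _ _ _⟩

instance : IsIso (K.pOpcycles 0) :=
  K.isIso_pOpcycles 0 0 (by simp) (by simp)

section Projective

variable [∀ j, Projective (K.X j)]

lemma hasProjectiveDimensionLE_opcycles (j : ℕ) (hK : ∀ i < j, K.ExactAt i) :
    HasProjectiveDimensionLE (K.opcycles j) j := by
  induction j with
  | zero => exact hasProjectiveDimensionLT_of_iso (asIso (K.pOpcycles 0)) 1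
  | succ j ih =>
    exact (shortExact_opcycles (hK j (by omega))).hasProjectiveDimensionLT_X₃ (j + 1)
      (ih fun i hi => hK i (by omega)) (hasProjectiveDimensionLT_of_ge (K.X (j + 1)) 1 _ (by omega))

variable [HasExt.{w} C]

lemma subsingleton_ext_opcycles {L : C}
    (hL : ∀ (m : ℕ) (f : K.X (m + 1) ⟶ L), K.d m (m + 1) ≫ f = 0 →
      ∃ g, K.d (m + 1) (m + 2) ≫ g = f)
    (i j : ℕ) (hK : ∀ t < j + i + 2, K.ExactAt t) :
    Subsingleton (Ext.{w} (K.opcycles (j + i + 2)) L (i + 1)) := by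
  have hS := shortExact_opcycles (hK (j + i + 1) (by omega))
  induction i with
  | zero =>
    refine subsingleton_ext_one_of_forall_exists_comp_eq hS fun h => ?_
    obtain ⟨g, hg⟩ := hL j (K.pOpcycles (j + 1) ≫ h) (by rw [K.d_pOpcycles_assoc, zero_comp])
    exact ⟨g, by rw [← cancel_epi (K.pOpcycles (j + 1)), K.p_fromOpcycles_assoc, hg]⟩
  | succ i ih =>
    have := ih (fun t ht => hK t (by omega)) (shortExact_opcycles (hK (j + i + 1) (by omega)))
    have : Subsingleton (Ext.{w} (K.X (j + i + 3)) L (i + 2)) :=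
      HasProjectiveDimensionLT.subsingleton _ 1 _ (by omega) _
    exact subsingleton_ext_X₃ hS L (i + 1)

variable {K} in
lemma exists_isExtPresentation_opcycles {X L : C} {N : ℕ} {η : Ext.{w} X (K.X 0) N}
    (hη : IsExtPresentation η (K.d 0 1) L (add_zero N))
    (hX : ∀ i j, 1 ≤ i → i < N → Subsingleton (Ext.{w} X (K.X j) i))
    (s j : ℕ) (h : s + 1 + j = N) (hK : ∀ i < j, K.ExactAt i) :
    ∃ ξ : Ext.{w} X (K.opcycles j) (s + 1),
      IsExtPresentation ξ (K.fromOpcycles j (j + 1)) L h := by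
  induction j generalizing s with
  | zero =>
    obtain rfl : s + 1 = N := h
    rw [← K.p_fromOpcycles] at hη
    exact ⟨_, hη.comp_iso (asIso (K.pOpcycles 0))⟩
  | succ j ih =>
    obtain ⟨ξ, hξ⟩ := ih (s + 1) (by omega) fun i hi => hK i (by omega)
    have := hX (s + 1) (j + 2) (by omega) (by omega)
    exact hξ.exists_succ (shortExact_opcycles (hK j (by omega))) _

end Projective

end Opcycles

lemma quasiIso_toSingle₀Equiv_symm {K : ChainComplex C ℕ} {X : C} (p : K.X 0 ⟶ X) [Epi p]
    (w : K.d 1 0 ≫ p = 0) (hp : (ShortComplex.mk (K.d 1 0) p w).Exact)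
    (hK : ∀ i, K.ExactAt (i + 1)) :
    QuasiIso ((ChainComplex.toSingle₀Equiv K X).symm ⟨p, w⟩) where
  quasiIsoAt
    | 0 => by
      rw [ChainComplex.quasiIsoAt₀_iff, ShortComplex.quasiIso_iff_of_zeros' _
        (K.shape _ _ (by simp)) (HomologicalComplex.single_obj_d (.down ℕ) _ _ _ _)
        (HomologicalComplex.single_obj_d (.down ℕ) _ _ _ _)]
      refine (ShortComplex.exact_and_epi_g_iff_of_iso ?_).2 ⟨hp, ‹Epi p›⟩
      exact ShortComplex.isoMk (Iso.refl _) (Iso.refl _) (Iso.refl _)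
        ((Category.id_comp _).trans (Category.comp_id _).symm)
        ((Category.id_comp _).trans ((ChainComplex.toSingle₀Equiv_symm_apply_f_zero p w).symm.trans
          (Category.comp_id _).symm))
    | i + 1 =>
      (quasiIsoAt_iff_exactAt' _ _ (ChainComplex.exactAt_succ_single_obj _ _)).2 (hK i)

lemma shortExact_kernel_comp {X Y Z : C} (f : X ⟶ Y) (g : Y ⟶ Z) [Epi f] :
    (ShortComplex.mk (kernel.map f (f ≫ g) (𝟙 X) g (by simp))
      (kernel.map (f ≫ g) g f (𝟙 Z) (by simp)) (by cat_disch)).ShortExact where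
  exact := (kernelCokernelCompSequence_exact f g).exact 0
  mono_f := mono_of_mono_fac (kernel.lift_ι _ _ _)
  epi_g := ((kernelCokernelCompSequence_exact f g).exact 1).epi_f (zero_of_target_iso_zero _
    (cokernel.ofEpi f))

lemma hasProjectiveDimensionLT_kernel_comp {X Y Z : C} (f : X ⟶ Y) (g : Y ⟶ Z) [Epi f] (n : ℕ)
    [h : HasProjectiveDimensionLT (kernel f) n] [h' : HasProjectiveDimensionLT (kernel g) n] :
    HasProjectiveDimensionLT (kernel (f ≫ g)) n :=
  (shortExact_kernel_comp f g).hasProjectiveDimensionLT_X₂ n h h'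

end AbelianCategory

section Modules

variable {R : Type u} [Ring R]

section Free

lemma id_eq_sum_coord {ι : Type*} [Fintype ι] {F : ModuleCat.{u} R} (b : Module.Basis ι R F) :
    𝟙 F = ∑ i, ModuleCat.ofHom (b.coord i) ≫
      ModuleCat.ofHom (LinearMap.toSpanSingleton R F (b i)) := by
  ext x
  simp [ModuleCat.hom_sum, LinearMap.sum_apply, b.sum_repr]

lemma ext_eq_sum_comp_coord {ι : Type*} [Fintype ι] {F : ModuleCat.{u} R} (b : Module.Basis ι R F)
    {Y : ModuleCat.{u} R} {n : ℕ} (θ : Ext.{u} Y F n) :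
    θ = ∑ i, (θ.comp (Ext.mk₀ (ModuleCat.ofHom (b.coord i))) (add_zero n)).comp
      (Ext.mk₀ (ModuleCat.ofHom (LinearMap.toSpanSingleton R F (b i)))) (add_zero n) := by
  conv_lhs => rw [← Ext.comp_mk₀_id θ, id_eq_sum_coord b]
  simp only [Ext.mk₀_sum, Ext.comp_sum, Ext.comp_assoc_of_third_deg_zero, Ext.mk₀_comp_mk₀]

variable {F : ModuleCat.{u} R} [Module.Free R F] [Module.Finite R F]

lemma ext_eq_zero_of_forall_functional {Y : ModuleCat.{u} R} {n : ℕ} (θ : Ext.{u} Y F n)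
    (h : ∀ f : F ⟶ ModuleCat.of R R, θ.comp (Ext.mk₀ f) (add_zero n) = 0) : θ = 0 := by
  rw [ext_eq_sum_comp_coord (Module.Free.chooseBasis R F) θ]
  exact Finset.sum_eq_zero fun i _ => by rw [h, Ext.zero_comp]

lemma subsingleton_ext_of_free (Y : ModuleCat.{u} R) (n : ℕ)
    [Subsingleton (Ext.{u} Y (ModuleCat.of R R) n)] : Subsingleton (Ext.{u} Y F n) :=
  subsingleton_of_forall_eq 0 fun θ =>
    ext_eq_zero_of_forall_functional θ fun _ => Subsingleton.elim _ _

end Free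

section Resolution

variable [IsNoetherianRing R]

lemma exists_exact_fin_fun {m : ℕ} {Y : Type*} [AddCommGroup Y] [Module R Y]
    (f : (Fin m → R) →ₗ[R] Y) :
    ∃ (l : ℕ) (g : (Fin l → R) →ₗ[R] (Fin m → R)), Function.Exact g f := by
  obtain ⟨l, g, hg⟩ := Module.Finite.exists_fin' R (LinearMap.ker f)
  refine ⟨l, (LinearMap.ker f).subtype ∘ₗ g, ?_⟩
  rw [LinearMap.exact_iff, LinearMap.range_comp_of_range_eq_top _ (LinearMap.range_eq_top.2 hg),
    Submodule.range_subtype]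

lemma exists_exact_sequence_fin_fun (X : Type*) [AddCommGroup X] [Module R X]
    [Module.Finite R X] :
    ∃ (m : ℕ → ℕ) (d : ∀ i, (Fin (m (i + 1)) → R) →ₗ[R] (Fin (m i) → R))
      (p : (Fin (m 0) → R) →ₗ[R] X), Function.Surjective p ∧ Function.Exact (d 0) p ∧
        ∀ i, Function.Exact (d (i + 1)) (d i) := by
  obtain ⟨m₀, p, hp⟩ := Module.Finite.exists_fin' R X
  obtain ⟨m₁, d₀, hd₀⟩ := exists_exact_fin_fun p
  choose c g hg using fun (a b : ℕ) (f : (Fin a → R) →ₗ[R] (Fin b → R)) => exists_exact_fin_fun f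
  let D : ℕ → Σ (a b : ℕ), (Fin a → R) →ₗ[R] (Fin b → R) := fun n =>
    Nat.rec ⟨m₁, m₀, d₀⟩ (fun _ s => ⟨c s.1 s.2.1 s.2.2, s.1, g s.1 s.2.1 s.2.2⟩) n
  exact ⟨fun i => (D i).2.1, fun i => (D i).2.2, p, hp, hd₀, fun i => hg _ _ _⟩

lemma exists_projectiveResolution_free (M : ModuleCat.{u} R) [Module.Finite R M] :
    ∃ P : ProjectiveResolution M,
      ∀ i, Module.Free R (P.complex.X i) ∧ Module.Finite R (P.complex.X i) := by
  obtain ⟨m, d, p, hp, hdp, hd⟩ := exists_exact_sequence_fin_fun (R := R) M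
  let K : ChainComplex (ModuleCat.{u} R) ℕ :=
    ChainComplex.of (fun i => ModuleCat.of R (Fin (m i) → R)) (fun i => ModuleCat.ofHom (d i))
      fun i => ModuleCat.hom_ext (hd i).linearMap_comp_eq_zero
  have hK (i : ℕ) : K.d (i + 1) i = ModuleCat.ofHom (d i) := by
    simp only [K, ChainComplex.of_d]
  have hK₀ : K.d 1 0 ≫ ModuleCat.ofHom p = 0 := by
    rw [hK]
    exact ModuleCat.hom_ext hdp.linearMap_comp_eq_zero
  have hKp : (ShortComplex.mk (K.d 1 0) (ModuleCat.ofHom p) hK₀).Exact := by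
    refine ModuleCat.shortComplex_exact _ ?_
    change Function.Exact (K.d 1 0) p
    rwa [hK]
  have hK' (i : ℕ) : K.ExactAt (i + 1) := by
    rw [K.exactAt_iff' (i + 2) (i + 1) i (by simp) (by simp)]
    refine ModuleCat.shortComplex_exact _ ?_
    change Function.Exact (K.d (i + 2) (i + 1)) (K.d (i + 1) i)
    rw [hK, hK]
    exact hd i
  have : Epi (ModuleCat.ofHom p) := (ModuleCat.epi_iff_surjective _).2 hp
  let P : ProjectiveResolution M :=
    { complex := K
      π := (ChainComplex.toSingle₀Equiv K M).symm ⟨ModuleCat.ofHom p, hK₀⟩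
      projective := fun i => inferInstanceAs (Projective (ModuleCat.of R (Fin (m i) → R)))
      quasiIso := quasiIso_toSingle₀Equiv_symm _ hK₀ hKp hK' }
  exact ⟨P, fun i => ⟨inferInstanceAs (Module.Free R (Fin (m i) → R)),
    inferInstanceAs (Module.Finite R (Fin (m i) → R))⟩⟩

end Resolution

end Modules

section DualComplex

variable {Λ : Type u} [Ring Λ]

section DualOfFree

variable {P : Type u} [AddCommGroup P] [Module Λᵐᵒᵖ P]

lemma dual_eq_sum_smul_constr {ι : Type*} [Fintype ι] [DecidableEq ι] (b : Module.Basis ι Λᵐᵒᵖ P)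
    (f : P →ₗ[Λᵐᵒᵖ] Λ) : f = ∑ i, f (b i) • b.constr Λ (Pi.single i (1 : Λ)) :=
  b.ext fun j => by simp [LinearMap.sum_apply, Pi.single_apply]

variable [Module.Free Λᵐᵒᵖ P] [Module.Finite Λᵐᵒᵖ P]

instance : Module.Free Λ (P →ₗ[Λᵐᵒᵖ] Λ) :=
  .of_equiv ((Module.Free.chooseBasis Λᵐᵒᵖ P).constr Λ)

instance : Module.Finite Λ (P →ₗ[Λᵐᵒᵖ] Λ) :=
  .equiv ((Module.Free.chooseBasis Λᵐᵒᵖ P).constr Λ)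

lemma exists_applyₗ'_eq (φ : (P →ₗ[Λᵐᵒᵖ] Λ) →ₗ[Λ] Λ) : ∃ w : P, LinearMap.applyₗ' Λ w = φ := by
  classical
  let b := Module.Free.chooseBasis Λᵐᵒᵖ P
  refine ⟨∑ i, op (φ (b.constr Λ (Pi.single i 1))) • b i, LinearMap.ext fun f => ?_⟩
  conv_rhs => rw [dual_eq_sum_smul_constr b f]
  simp

lemma exists_ext_comp_applyₗ'_eq {X : ModuleCat.{u} Λ} {n : ℕ} (p : P →ₗ[Λᵐᵒᵖ] ExtRing X n) :
    ∃ η : Ext.{u} X (ModuleCat.of Λ (P →ₗ[Λᵐᵒᵖ] Λ)) n, ∀ w,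
      η.comp (Ext.mk₀ (ModuleCat.ofHom (LinearMap.applyₗ' Λ w))) (add_zero n) = p w := by
  classical
  let b := Module.Free.chooseBasis Λᵐᵒᵖ P
  let c i := ModuleCat.ofHom (LinearMap.toSpanSingleton Λ _ (b.constr Λ (Pi.single i (1 : Λ))))
  let x i : Ext.{u} X (ModuleCat.of Λ Λ) n := p (b i)
  refine ⟨∑ i, (x i).comp (Ext.mk₀ (c i)) (add_zero n), fun w => ?_⟩
  have hc (i) : c i ≫ ModuleCat.ofHom (LinearMap.applyₗ' Λ w) = rightMul (b.repr w i).unop := by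
    ext
    simp [c, rightMul, Module.Basis.constr_apply_fintype, Pi.single_apply]
  conv_rhs => rw [← b.sum_repr w, map_sum]
  rw [Ext.sum_comp]
  refine Finset.sum_congr rfl fun i _ => ?_
  rw [Ext.comp_assoc_of_third_deg_zero, Ext.mk₀_comp_mk₀, hc, p.map_smul]
  rfl

end DualOfFree

/-- The dual `Hom(P₀, Λ) ⟶ Hom(P₁, Λ) ⟶ ⋯` of a chain complex of right `Λ`-modules; it consists of
left `Λ`-modules through the left multiplication of `Λ`. -/
noncomputable def dualComplex (P : ChainComplex (ModuleCat.{u} Λᵐᵒᵖ) ℕ) :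
    CochainComplex (ModuleCat.{u} Λ) ℕ :=
  CochainComplex.of (fun j => ModuleCat.of Λ (P.X j →ₗ[Λᵐᵒᵖ] Λ))
    (fun j => ModuleCat.ofHom (LinearMap.lcomp Λ Λ (P.d (j + 1) j).hom)) fun j => by
      ext f x
      exact (congrArg f
        (ConcreteCategory.congr_hom (P.d_comp_d (j + 2) (j + 1) j) x)).trans
          (map_zero f)

lemma dualComplex_d (P : ChainComplex (ModuleCat.{u} Λᵐᵒᵖ) ℕ) (j : ℕ) :
    (dualComplex P).d j (j + 1) = ModuleCat.ofHom (LinearMap.lcomp Λ Λ (P.d (j + 1) j).hom) :=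
  CochainComplex.of_d (fun j => ModuleCat.of Λ (P.X j →ₗ[Λᵐᵒᵖ] Λ))
    (fun j => ModuleCat.ofHom (LinearMap.lcomp Λ Λ (P.d (j + 1) j).hom)) j

section Eval

variable {P : ChainComplex (ModuleCat.{u} Λᵐᵒᵖ) ℕ} {j : ℕ}

instance [Module.Free Λᵐᵒᵖ (P.X j)] [Module.Finite Λᵐᵒᵖ (P.X j)] :
    Module.Free Λ ((dualComplex P).X j) :=
  inferInstanceAs (Module.Free Λ (P.X j →ₗ[Λᵐᵒᵖ] Λ))

instance [Module.Free Λᵐᵒᵖ (P.X j)] [Module.Finite Λᵐᵒᵖ (P.X j)] :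
    Module.Finite Λ ((dualComplex P).X j) :=
  inferInstanceAs (Module.Finite Λ (P.X j →ₗ[Λᵐᵒᵖ] Λ))

/-- Evaluation at `w`, as a functional on the dual complex. -/
def dualEval (w : P.X j) : (dualComplex P).X j ⟶ ModuleCat.of Λ Λ :=
  ModuleCat.ofHom (LinearMap.applyₗ' Λ w)

lemma d_comp_dualEval (w : P.X (j + 1)) :
    (dualComplex P).d j (j + 1) ≫ dualEval w = dualEval (P.d (j + 1) j w) := by
  rw [dualComplex_d]
  rfl

lemma eq_zero_of_dualEval_eq_zero [Module.Free Λᵐᵒᵖ (P.X j)] {w : P.X j} (hw : dualEval w = 0) :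
    w = 0 :=
  (Module.forall_dual_apply_eq_zero_iff Λᵐᵒᵖ w).1 fun f =>
    unop_injective (ConcreteCategory.congr_hom hw ((opLinearEquiv Λᵐᵒᵖ).symm.toLinearMap ∘ₗ f))

lemma dualEval_surjective [Module.Free Λᵐᵒᵖ (P.X j)] [Module.Finite Λᵐᵒᵖ (P.X j)] :
    Function.Surjective (dualEval : P.X j → ((dualComplex P).X j ⟶ ModuleCat.of Λ Λ)) :=
  fun f => (exists_applyₗ'_eq f.hom).imp fun _ h => ModuleCat.hom_ext h

end Eval

variable {N : ModuleCat.{u} Λᵐᵒᵖ} (P : ProjectiveResolution N)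

lemma exactAt_dualComplex {n : ℕ} (hN : GradeGE n N) {j : ℕ} (hj : j < n) :
    (dualComplex P.complex).ExactAt j := by
  have := hN j hj
  have hd {i : ℕ} {f : P.complex.X i →ₗ[Λᵐᵒᵖ] Λ} (hf : (dualComplex P.complex).d i (i + 1) f = 0) :
      P.complex.d (i + 1) i ≫ ModuleCat.ofHom f = 0 := by
    rw [dualComplex_d] at hf
    exact ModuleCat.hom_ext hf
  cases j with
  | zero =>
    rw [HomologicalComplex.exactAt_iff' _ 0 0 1 (by simp) (by simp),
      ShortComplex.moduleCat_exact_iff]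
    intro f hf
    have hN₀ (g : N ⟶ ModuleCat.of Λᵐᵒᵖ Λ) : g = 0 :=
      (Ext.mk₀_bijective _ _).1 (Subsingleton.elim _ _)
    refine ⟨0, (map_zero _).trans (congrArg ModuleCat.Hom.hom (?_ : 0 = ModuleCat.ofHom _))⟩
    rw [← P.exact₀.g_desc _ (hd hf)]
    exact (comp_zero (f := P.π.f 0)).symm.trans (congrArg _ (hN₀ _).symm)
  | succ j =>
    rw [HomologicalComplex.exactAt_iff' _ j (j + 1) (j + 2) (by simp) (by simp),
      ShortComplex.moduleCat_exact_iff]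
    intro f hf
    obtain ⟨g, hg⟩ := (P.extMk_eq_zero_iff _ _ rfl (hd hf) j rfl).1 (Subsingleton.elim _ _)
    refine ⟨g.hom, ?_⟩
    change (dualComplex P.complex).d j (j + 1) g.hom = f
    rw [dualComplex_d]
    exact congrArg ModuleCat.Hom.hom hg

variable [∀ i, Module.Free Λᵐᵒᵖ (P.complex.X i)] [∀ i, Module.Finite Λᵐᵒᵖ (P.complex.X i)]

lemma exists_dualComplex_d_comp_eq (m : ℕ)
    (f : (dualComplex P.complex).X (m + 1) ⟶ ModuleCat.of Λ Λ)
    (hf : (dualComplex P.complex).d m (m + 1) ≫ f = 0) :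
    ∃ g, (dualComplex P.complex).d (m + 1) (m + 2) ≫ g = f := by
  obtain ⟨w, rfl⟩ := dualEval_surjective f
  rw [d_comp_dualEval] at hf
  obtain ⟨w', rfl⟩ := (ShortComplex.moduleCat_exact_iff _).1 (P.exact_succ m) w
    (eq_zero_of_dualEval_eq_zero hf)
  exact ⟨dualEval w', d_comp_dualEval w'⟩

lemma exists_isExtPresentation_dualComplex {X : ModuleCat.{u} Λ} {n : ℕ}
    (P : ProjectiveResolution (ModuleCat.of Λᵐᵒᵖ (ExtRing X n)))
    [∀ i, Module.Free Λᵐᵒᵖ (P.complex.X i)] [∀ i, Module.Finite Λᵐᵒᵖ (P.complex.X i)] :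
    ∃ η : Ext.{u} X ((dualComplex P.complex).X 0) n,
      IsExtPresentation η ((dualComplex P.complex).d 0 1) (ModuleCat.of Λ Λ) (add_zero n) := by
  let p : P.complex.X 0 →ₗ[Λᵐᵒᵖ] ExtRing X n := (P.π.f 0).hom
  have hp : Function.Exact (P.complex.d 1 0).hom p :=
    (ShortComplex.ShortExact.moduleCat_exact_iff_function_exact _).1 P.exact₀
  obtain ⟨η, hη⟩ : ∃ η : Ext.{u} X ((dualComplex P.complex).X 0) n, ∀ w,
      η.comp (Ext.mk₀ (dualEval w)) (add_zero n) = p w := exists_ext_comp_applyₗ'_eq p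
  refine ⟨η, ext_eq_zero_of_forall_functional _ fun f => ?_, fun z => ?_, fun y hy => ?_⟩
  · obtain ⟨w, rfl⟩ := dualEval_surjective f
    rw [Ext.comp_assoc_of_third_deg_zero, Ext.mk₀_comp_mk₀, d_comp_dualEval]
    exact (hη _).trans (hp.apply_apply_eq_zero w)
  · obtain ⟨w, rfl⟩ := (ModuleCat.epi_iff_surjective (P.π.f 0)).1 inferInstance z
    exact ⟨_, hη w⟩
  · obtain ⟨f, rfl⟩ := (Ext.mk₀_bijective _ _).2 y
    obtain ⟨w, rfl⟩ := dualEval_surjective f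
    obtain ⟨w', rfl⟩ := (hp w).1 ((hη w).symm.trans hy)
    refine ⟨Ext.mk₀ (dualEval w'), ?_⟩
    rw [Ext.mk₀_comp_mk₀, d_comp_dualEval]

end DualComplex

section Cocycle

variable {Λ : Type u} [Ring Λ] {M : ModuleCat.{u} Λ} (P : ProjectiveResolution M)

/-- The class in `Extⁿ(M, Λ)` of a cocycle of the dual of the projective resolution `P`. -/
noncomputable def cocycleClass (n : ℕ) :
    LinearMap.ker (LinearMap.lcomp Λᵐᵒᵖ Λ (P.complex.d (n + 1) n).hom) →ₗ[Λᵐᵒᵖ] ExtRing M n where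
  toFun f := P.extMk (ModuleCat.ofHom f.1) (n + 1) rfl (ModuleCat.hom_ext f.2)
  map_add' f g := (P.add_extMk (ModuleCat.ofHom f.1) (ModuleCat.ofHom g.1) (n + 1) rfl
    (ModuleCat.hom_ext f.2) (ModuleCat.hom_ext g.2)).symm
  map_smul' r f := (P.extMk_comp_mk₀ (ModuleCat.ofHom f.1) (n + 1) rfl
    (ModuleCat.hom_ext f.2) (rightMul r.unop)).symm

lemma cocycleClass_surjective (n : ℕ) : Function.Surjective (cocycleClass P n) := by
  intro z
  obtain ⟨f, hf, h⟩ := P.extMk_surjective z (n + 1) rfl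
  exact ⟨⟨f.hom, congrArg ModuleCat.Hom.hom hf⟩, h⟩

lemma cocycleClass_eq_zero {n : ℕ} (f) (g : P.complex.X n →ₗ[Λ] Λ)
    (h : g ∘ₗ (P.complex.d (n + 1) n).hom = f.1) : cocycleClass P (n + 1) f = 0 :=
  (P.extMk_eq_zero_iff (ModuleCat.ofHom f.1) (n + 2) rfl (ModuleCat.hom_ext f.2) n rfl).2
    ⟨ModuleCat.ofHom g, ModuleCat.hom_ext h⟩

instance {P : Type*} [AddCommGroup P] [Module Λ P] [Module.Free Λ P] [Module.Finite Λ P] :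
    Module.Free Λᵐᵒᵖ (P →ₗ[Λ] Λ) :=
  have : Module.Free Λᵐᵒᵖ Λ := .of_equiv (opLinearEquiv Λᵐᵒᵖ).symm
  .of_equiv ((Module.Free.chooseBasis Λ P).constr Λᵐᵒᵖ)

instance {P : Type*} [AddCommGroup P] [Module Λ P] [Module.Free Λ P] [Module.Finite Λ P] :
    Module.Finite Λᵐᵒᵖ (P →ₗ[Λ] Λ) :=
  have : Module.Finite Λᵐᵒᵖ Λ := .equiv (opLinearEquiv Λᵐᵒᵖ).symm
  .equiv ((Module.Free.chooseBasis Λ P).constr Λᵐᵒᵖ)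

lemma finite_extRing [IsNoetherianRing Λ] [IsNoetherianRing Λᵐᵒᵖ] (M : ModuleCat.{u} Λ)
    [Module.Finite Λ M] (n : ℕ) : Module.Finite Λᵐᵒᵖ (ExtRing M n) := by
  obtain ⟨P, hP⟩ := exists_projectiveResolution_free M
  have := (hP n).1
  have := (hP n).2
  exact .of_surjective _ (cocycleClass_surjective P n)

end Cocycle

section ExtRing

variable {Λ : Type u} [Ring Λ]

lemma GradeGE.of_iso {i : ℕ} {N N' : ModuleCat.{u} Λᵐᵒᵖ} (e : N ≅ N') (h : GradeGE i N) :
    GradeGE i N' := fun j hj =>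
  have := h j hj
  subsingleton_of_forall_eq 0 fun x => by
    rw [← Ext.mk₀_id_comp x, ← e.inv_hom_id, ← Ext.mk₀_comp_mk₀_assoc,
      Subsingleton.elim ((Ext.mk₀ e.hom).comp x _) 0, Ext.comp_zero]

lemma StrongGradeGE.gradeGE {i : ℕ} {N : ModuleCat.{u} Λᵐᵒᵖ} (h : StrongGradeGE i N) :
    GradeGE i N :=
  (h ⊤).of_iso Submodule.topEquiv.toModuleIso

/-- The map `Extⁿ(M, Λ) → Extⁿ(X, Λ)` of right modules induced by `f : X ⟶ M`. -/
noncomputable def extRingMap {X M : ModuleCat.{u} Λ} (f : X ⟶ M) (n : ℕ) :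
    ExtRing M n →ₗ[Λᵐᵒᵖ] ExtRing X n where
  toFun x := (Ext.mk₀ f).comp x (zero_add n)
  map_add' _ _ := Ext.comp_add _ _ _ _
  map_smul' _ _ := (Ext.comp_assoc_of_third_deg_zero _ _ _ _).symm

lemma extRingMap_bijective {X M : ModuleCat.{u} Λ} (f : X ⟶ M) [Epi f] (n : ℕ)
    [HasProjectiveDimensionLT (kernel f) n] : Function.Bijective (extRingMap f (n + 1)) := by
  have hS : (ShortComplex.mk _ f (kernel.condition f)).ShortExact :=
    { exact := ShortComplex.exact_kernel f }
  refine ⟨(injective_iff_map_eq_zero _).2 fun x hx => ?_, fun x => ?_⟩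
  · obtain ⟨y, hy⟩ := Ext.contravariant_sequence_exact₃ hS _ x hx (add_comm 1 n)
    rw [Ext.eq_zero_of_hasProjectiveDimensionLT y n le_rfl, Ext.comp_zero] at hy
    exact hy.symm
  · exact Ext.contravariant_sequence_exact₂ hS _ x
      (Ext.eq_zero_of_hasProjectiveDimensionLT _ n (by omega))

lemma gradeGE_extRing_of_epi {X M : ModuleCat.{u} Λ} (f : X ⟶ M) [Epi f] {i n : ℕ}
    [HasProjectiveDimensionLT (kernel f) n]
    (h : GradeGE i (ModuleCat.of Λᵐᵒᵖ (ExtRing M (n + 1)))) :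
    GradeGE i (ModuleCat.of Λᵐᵒᵖ (ExtRing X (n + 1))) :=
  h.of_iso (LinearEquiv.ofBijective _ (extRingMap_bijective f n)).toModuleIso

lemma isWModule_succ_of_isExtPresentation {S : ShortComplex (ModuleCat.{u} Λ)} (hS : S.ShortExact)
    {n : ℕ} (hW : IsWModule n S.X₃) [HasProjectiveDimensionLE S.X₁ n]
    (hQ : ∀ i, 1 ≤ i → i < n → Subsingleton (Ext.{u} S.X₁ (ModuleCat.of Λ Λ) i))
    {P : ModuleCat.{u} Λ} [Projective P] {ι : S.X₁ ⟶ P}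
    (hξ : IsExtPresentation hS.extClass ι (ModuleCat.of Λ Λ) (add_comm 1 n)) :
    IsWModule (n + 1) S.X₂ := by
  intro l hl hln
  refine subsingleton_of_forall_eq (α := Ext.{u} S.X₂ (ModuleCat.of Λ Λ) l) 0 fun x => ?_
  have hx : (Ext.mk₀ S.f).comp x (zero_add l) = 0 := by
    rcases lt_trichotomy l n with hlt | rfl | hlt
    · have := hQ l hl hlt
      exact Subsingleton.elim _ _
    · obtain ⟨g, hg⟩ := hξ.exact _ (hS.extClass_comp_assoc x)
      rw [← hg, Ext.eq_zero_of_hasProjectiveDimensionLT g 1 hl, Ext.comp_zero]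
    · exact Ext.eq_zero_of_hasProjectiveDimensionLT _ (n + 1) hlt
  obtain ⟨y, rfl⟩ := Ext.contravariant_sequence_exact₂ hS _ x hx
  obtain rfl | hlt := hln.eq_or_lt
  · obtain ⟨z, rfl⟩ := hξ.surjective y
    exact hS.comp_extClass_assoc z _
  · have : Subsingleton (Ext.{u} S.X₃ (ModuleCat.of Λ Λ) l) := hW l hl (by omega)
    rw [Subsingleton.elim y 0, Ext.comp_zero]

end ExtRing

section Cover

variable {Λ : Type u} [Ring Λ] [IsNoetherianRing Λ] [IsNoetherianRing Λᵐᵒᵖ]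

lemma exists_isExtPresentation_of_gradeGE (X : ModuleCat.{u} Λ) [Module.Finite Λ X] {n : ℕ}
    (hW : IsWModule n X) (hG : GradeGE n (ModuleCat.of Λᵐᵒᵖ (ExtRing X (n + 1)))) :
    ∃ (Q P : ModuleCat.{u} Λ) (ι : Q ⟶ P) (ξ : Ext.{u} X Q 1), Module.Finite Λ Q ∧ Projective P ∧
      HasProjectiveDimensionLE Q n ∧
      (∀ i, 1 ≤ i → i < n → Subsingleton (Ext.{u} Q (ModuleCat.of Λ Λ) i)) ∧
      IsExtPresentation ξ ι (ModuleCat.of Λ Λ) (add_comm 1 n) := by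
  have := finite_extRing X (n + 1)
  obtain ⟨P, hP⟩ := exists_projectiveResolution_free (ModuleCat.of Λᵐᵒᵖ (ExtRing X (n + 1)))
  have hfree i := (hP i).1
  have hfin i := (hP i).2
  let K := dualComplex P.complex
  have hproj (j : ℕ) : Projective (K.X j) :=
    ModuleCat.projective_of_free (Module.Free.chooseBasis Λ (K.X j))
  have hK (i : ℕ) (hi : i < n) : K.ExactAt i := exactAt_dualComplex P hG hi
  obtain ⟨η, hη⟩ := exists_isExtPresentation_dualComplex P
  have hX (i j : ℕ) (hi : 1 ≤ i) (hi' : i < n + 1) : Subsingleton (Ext.{u} X (K.X j) i) :=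
    have : Subsingleton (Ext.{u} X (ModuleCat.of Λ Λ) i) := hW i hi (by omega)
    subsingleton_ext_of_free X i
  obtain ⟨ξ, hξ⟩ := exists_isExtPresentation_opcycles hη hX 0 n (by omega) hK
  refine ⟨K.opcycles n, _, _, ξ, .of_surjective (K.pOpcycles n).hom
    ((ModuleCat.epi_iff_surjective _).1 inferInstance), hproj (n + 1),
    hasProjectiveDimensionLE_opcycles K n hK, fun i hi hin => ?_, hξ⟩
  obtain ⟨i, rfl⟩ := Nat.exists_eq_add_of_le' hi
  obtain ⟨j, rfl⟩ := Nat.exists_eq_add_of_le' (show i + 2 ≤ n by omega)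
  exact subsingleton_ext_opcycles K (exists_dualComplex_d_comp_eq P) i j hK

lemma exists_isWModule_succ_cover (X : ModuleCat.{u} Λ) [Module.Finite Λ X] {n : ℕ}
    (hW : IsWModule n X) (hG : GradeGE n (ModuleCat.of Λᵐᵒᵖ (ExtRing X (n + 1)))) :
    ∃ (E : ModuleCat.{u} Λ) (q : E ⟶ X), Epi q ∧ Module.Finite Λ E ∧
      HasProjectiveDimensionLE (kernel q) n ∧ IsWModule (n + 1) E := by
  obtain ⟨Q, P, ι, ξ, hQ, hP, hQpd, hQvan, hξ⟩ := exists_isExtPresentation_of_gradeGE X hW hG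
  obtain ⟨E, i, q, w, hS, rfl⟩ := exists_shortExact_extClass_eq ξ
  have hE : Module.Finite Λ E :=
    .of_exact ((ShortComplex.ShortExact.moduleCat_exact_iff_function_exact _).1 hS.exact)
      hS.moduleCat_surjective_g
  let e : Q ≅ kernel q := hS.fIsKernel.conePointUniqueUpToIso (limit.isLimit _)
  exact ⟨E, q, hS.epi_g, hE, hasProjectiveDimensionLT_of_iso e (n + 1),
    isWModule_succ_of_isExtPresentation hS hW hQvan hξ⟩

lemma exists_isWModule_cover (M : ModuleCat.{u} Λ) [Module.Finite Λ M] (n : ℕ)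
    (hG : ∀ t, 1 ≤ t → t < n → GradeGE t (ModuleCat.of Λᵐᵒᵖ (ExtRing M (t + 1)))) :
    ∃ (X : ModuleCat.{u} Λ) (p : X ⟶ M), Epi p ∧ Module.Finite Λ X ∧
      HasProjectiveDimensionLT (kernel p) n ∧ IsWModule n X := by
  induction n with
  | zero =>
    exact ⟨M, 𝟙 M, inferInstance, inferInstance,
      (isZero_kernel_of_mono _).hasProjectiveDimensionLT_zero, fun i hi hi' => by omega⟩
  | succ n ih =>
    obtain ⟨X, p, _, _, _, hW⟩ := ih fun t ht htn => hG t ht (by omega)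
    have hGX : GradeGE n (ModuleCat.of Λᵐᵒᵖ (ExtRing X (n + 1))) := by
      obtain rfl | hn := n.eq_zero_or_pos
      · exact fun j hj => by omega
      · exact gradeGE_extRing_of_epi p (hG n hn n.lt_succ_self)
    obtain ⟨E, q, _, hE, _, hWE⟩ := exists_isWModule_succ_cover X hW hGX
    have := hasProjectiveDimensionLT_of_ge (kernel p) n (n + 1) (by omega)
    exact ⟨E, q ≫ p, inferInstance, hE, hasProjectiveDimensionLT_kernel_comp q p (n + 1), hWE⟩

end Cover

section Approximation

variable {Λ : Type u} [Ring Λ]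

lemma addClosure_of {D : ObjectProperty (ModuleCat.{u} Λ)} {F : ModuleCat.{u} Λ} (h : D F) :
    addClosure D F :=
  ⟨ModuleCat.of Λ PUnit.{u + 1}, 1, fun _ => F, fun _ => h,
    ⟨LinearEquiv.prodUnique.trans (LinearEquiv.funUnique (Fin 1) Λ F).symm⟩⟩

lemma isLeftApproximation_of_forall_exists_comp_eq {D : ObjectProperty (ModuleCat.{u} Λ)}
    {M F : ModuleCat.{u} Λ} {f : M ⟶ F} (hF : D F)
    (h : ∀ (Y : ModuleCat.{u} Λ) (g : M ⟶ Y), D Y → ∃ g' : F ⟶ Y, f ≫ g' = g) :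
    IsLeftApproximation D f := by
  refine ⟨addClosure_of hF, ?_⟩
  rintro X ⟨Z, n, Y, hY, ⟨e⟩⟩ g
  choose g' hg' using fun i => h (Y i)
    (ModuleCat.ofHom (LinearMap.proj i ∘ₗ e.toLinearMap ∘ₗ LinearMap.inl Λ X Z ∘ₗ g.hom)) (hY i)
  refine ⟨ModuleCat.ofHom
    (LinearMap.fst Λ X Z ∘ₗ e.symm.toLinearMap ∘ₗ LinearMap.pi fun i => (g' i).hom), ?_⟩
  ext x
  have hx : (fun i => g' i (f x)) = e (g x, 0) :=
    funext fun i => ConcreteCategory.congr_hom (hg' i) x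
  change (e.symm fun i => g' i (f x)).1 = g x
  rw [hx, e.symm_apply_apply]

lemma exists_mono_free_of_isTorsionless [IsNoetherianRing Λᵐᵒᵖ] (X : ModuleCat.{u} Λ)
    [Module.Finite Λ X] (hX : IsTorsionless X) :
    ∃ (F : ModuleCat.{u} Λ) (j : X ⟶ F), Module.Free Λ F ∧ Module.Finite Λ F ∧ Mono j ∧
      ∀ f : X ⟶ ModuleCat.of Λ Λ, ∃ g, j ≫ g = f := by
  obtain ⟨l, π, hπ⟩ := Module.Finite.exists_fin' Λ X
  have : Module.Finite Λᵐᵒᵖ (X →ₗ[Λ] Λ) :=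
    .of_injective (LinearMap.lcomp Λᵐᵒᵖ Λ π) (LinearMap.lcomp_injective_of_surjective π hπ)
  obtain ⟨m, s, hs⟩ := Module.Finite.exists_fin (R := Λᵐᵒᵖ) (M := X →ₗ[Λ] Λ)
  have hj (f : X →ₗ[Λ] Λ) : ∃ g, g ∘ₗ LinearMap.pi s = f := by
    obtain ⟨c, rfl⟩ := (Submodule.mem_span_range_iff_exists_fun Λᵐᵒᵖ).1
      (hs.ge (Submodule.mem_top (x := f)))
    exact ⟨∑ i, c i • LinearMap.proj i, by ext x; simp [LinearMap.sum_apply]⟩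
  refine ⟨ModuleCat.of Λ (Fin m → Λ), ModuleCat.ofHom (LinearMap.pi s), inferInstance,
    inferInstance, (ModuleCat.mono_iff_injective _).2 ?_, fun f => ?_⟩
  · refine (injective_iff_map_eq_zero (LinearMap.pi s)).2 fun x hx =>
      (injective_iff_map_eq_zero _).1 hX x (LinearMap.ext fun f => ?_)
    obtain ⟨g, rfl⟩ := hj f
    exact (congrArg g hx).trans (map_zero g)
  · obtain ⟨g, hg⟩ := hj f.hom
    exact ⟨ModuleCat.ofHom g, ModuleCat.hom_ext hg⟩

lemma subsingleton_ext_of_hasProjectiveDimensionLE [IsNoetherianRing Λ] {Y : ModuleCat.{u} Λ}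
    (Z : ModuleCat.{u} Λ) [Module.Finite Λ Z] (n i : ℕ) (hZ : HasProjectiveDimensionLE Z n)
    (hY : ∀ l, i ≤ l → l ≤ i + n → Subsingleton (Ext.{u} Y (ModuleCat.of Λ Λ) l)) :
    Subsingleton (Ext.{u} Y Z i) := by
  induction n generalizing i Z with
  | zero =>
    obtain ⟨m, π, hπ⟩ := Module.Finite.exists_fin' Λ Z
    have := hY i le_rfl le_rfl
    have : Subsingleton (Ext.{u} Y (ModuleCat.of Λ (Fin m → Λ)) i) := subsingleton_ext_of_free Y i
    have : Projective Z := projective_iff_hasProjectiveDimensionLT_one.2 hZ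
    have := (ModuleCat.epi_iff_surjective (ModuleCat.ofHom π)).2 hπ
    refine subsingleton_of_forall_eq 0 fun x => ?_
    rw [← Ext.comp_mk₀_id x, ← Projective.factorThru_comp (𝟙 Z) (ModuleCat.ofHom π),
      ← Ext.mk₀_comp_mk₀, ← Ext.comp_assoc_of_third_deg_zero,
      Subsingleton.elim (x.comp (Ext.mk₀ _) _) 0, Ext.zero_comp]
  | succ n ih =>
    obtain ⟨m, π, hπ⟩ := Module.Finite.exists_fin' Λ Z
    have hS := LinearMap.shortExact_shortComplexKer hπ
    have hfree (l : ℕ) (hl : i ≤ l) (hl' : l ≤ i + n) :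
        Subsingleton (Ext.{u} Y (ModuleCat.of Λ (Fin m → Λ)) l) :=
      have := hY l hl (by omega)
      subsingleton_ext_of_free Y l
    have : Subsingleton (Ext.{u} Y π.shortComplexKer.X₂ i) := hfree i le_rfl (by omega)
    have : Subsingleton (Ext.{u} Y π.shortComplexKer.X₁ (i + 1)) :=
      ih (ModuleCat.of Λ (LinearMap.ker π)) (i + 1)
        (hS.hasProjectiveDimensionLT_X₁ (n + 1) (hasProjectiveDimensionLT_of_ge
          (ModuleCat.of Λ (Fin m → Λ)) 1 _ (by omega)) hZ)
        fun l hl hl' => hY l (by omega) (by omega)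
    exact subsingleton_ext_covariant_X₃ hS Y i

lemma hasLeftApproximation_of_epi [IsNoetherianRing Λ] [IsNoetherianRing Λᵐᵒᵖ]
    {X M : ModuleCat.{u} Λ} (p : X ⟶ M) [Epi p] [Module.Finite Λ X] (k : ℕ)
    [hp : HasProjectiveDimensionLT (kernel p) k] (hW : IsWModule k X) (hX : IsTorsionless X) :
    HasLeftApproximation (projDimLE Λ k) M := by
  obtain ⟨F, j, _, _, _, hj⟩ := exists_mono_free_of_isTorsionless X hX
  have := ModuleCat.projective_of_free (Module.Free.chooseBasis Λ F)
  have hS : (ShortComplex.mk j (cokernel.π j) (cokernel.condition j)).ShortExact :=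
    { exact := ShortComplex.exact_cokernel j }
  have hT : (ShortComplex.mk _ p (kernel.condition p)).ShortExact :=
    { exact := ShortComplex.exact_kernel p }
  have hY (l : ℕ) (hl : 1 ≤ l) (hlk : l ≤ 1 + k) :
      Subsingleton (Ext.{u} (cokernel j) (ModuleCat.of Λ Λ) l) := by
    obtain _ | _ | l := l
    · omega
    · exact subsingleton_ext_one_of_forall_exists_comp_eq hS hj
    · have : Subsingleton (Ext.{u} X (ModuleCat.of Λ Λ) (l + 1)) := hW _ (by omega) (by omega)
      have := Ext.subsingleton_of_projective F (ModuleCat.of Λ Λ) (l + 1)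
      exact subsingleton_ext_X₃ hS _ _
  have hF : projDimLE Λ k (pushout j p) :=
    ⟨.of_surjective (pushout.inl j p).hom ((ModuleCat.epi_iff_surjective _).1 inferInstance),
      (shortExact_pushout_X₃ hT j).hasProjectiveDimensionLT_X₃ k hp
        (hasProjectiveDimensionLT_of_ge F 1 _ (by omega))⟩
  refine ⟨_, pushout.inr j p, isLeftApproximation_of_forall_exists_comp_eq hF fun Z g hZ => ?_⟩
  have := hZ.1
  have := subsingleton_ext_of_hasProjectiveDimensionLE Z k 1 hZ.2 hY
  obtain ⟨h, hh⟩ := exists_comp_eq_of_subsingleton_ext_one hS (p ≫ g)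
  exact ⟨pushout.desc h g hh, pushout.inr_desc _ _ _⟩

lemma hasLeftApproximation_of_gradeGE [IsNoetherianRing Λ] [IsNoetherianRing Λᵐᵒᵖ] {k : ℕ}
    (hΛ : HasPropertyW Λ k) {M : ModuleCat.{u} Λ} [Module.Finite Λ M]
    (hG : ∀ t, 1 ≤ t → t < k → GradeGE t (ModuleCat.of Λᵐᵒᵖ (ExtRing M (t + 1)))) :
    HasLeftApproximation (projDimLE Λ k) M := by
  obtain ⟨X, p, _, hX, _, hW⟩ := exists_isWModule_cover M k hG
  exact hasLeftApproximation_of_epi p k hW (hΛ X hX hW)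

end Approximation

section Tensor

variable {Λ : Type u} [Ring Λ] {N : ModuleCat.{u} Λᵐᵒᵖ}

lemma tensorMap_comp {P Q R : ModuleCat.{u} Λ} (f : P →ₗ[Λ] Q) (g : Q →ₗ[Λ] R) :
    tensorMap N (g ∘ₗ f) = (tensorMap N g).comp (tensorMap N f) := by
  ext x
  exact congrArg _ congr($(LinearMap.lTensor_comp N (g.restrictScalars ℤ) (f.restrictScalars ℤ)) x)

lemma tensorRel_le_map {Q R : ModuleCat.{u} Λ} {g : Q →ₗ[Λ] R} (hg : Function.Surjective g) :
    tensorRel N R ≤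
      (tensorRel N Q).map (LinearMap.lTensor N (g.restrictScalars ℤ)).toAddMonoidHom := by
  refine (AddSubgroup.closure_le _).2 ?_
  rintro _ ⟨n, r, y, rfl⟩
  obtain ⟨x, rfl⟩ := hg y
  exact ⟨_, AddSubgroup.subset_closure ⟨n, r, x, rfl⟩, by simp⟩

lemma exact_tensorMap_of_surjective (N : ModuleCat.{u} Λᵐᵒᵖ) {P Q R : ModuleCat.{u} Λ}
    {f : P →ₗ[Λ] Q} {g : Q →ₗ[Λ] R} (hfg : Function.Exact f g) (hg : Function.Surjective g) :
    Function.Exact (tensorMap N f) (tensorMap N g) := by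
  refine fun x => ⟨fun hx => ?_, ?_⟩
  · obtain ⟨x, rfl⟩ := QuotientAddGroup.mk_surjective x
    obtain ⟨z, hz, hzx⟩ := tensorRel_le_map hg ((QuotientAddGroup.eq_zero_iff _).1 hx)
    obtain ⟨y, hy⟩ := (lTensor_exact (f := f.restrictScalars ℤ) (g := g.restrictScalars ℤ) N hfg hg
      (x - z)).1 (by rw [map_sub, sub_eq_zero]; exact hzx.symm)
    refine ⟨QuotientAddGroup.mk y, (congrArg QuotientAddGroup.mk hy).trans ?_⟩
    rw [QuotientAddGroup.mk_sub, (QuotientAddGroup.eq_zero_iff z).2 hz, sub_zero]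
  · rintro ⟨y, rfl⟩
    obtain ⟨y, rfl⟩ := QuotientAddGroup.mk_surjective y
    rw [← AddMonoidHom.comp_apply, ← tensorMap_comp, hfg.linearMap_comp_eq_zero]
    change QuotientAddGroup.mk (LinearMap.lTensor N (0 : P →ₗ[ℤ] R) y) = _
    rw [LinearMap.lTensor_zero, LinearMap.zero_apply, QuotientAddGroup.mk_zero]

lemma IsFlatRight.exact_tensorMap (hN : IsFlatRight N) {P Q R : ModuleCat.{u} Λ}
    {f : P →ₗ[Λ] Q} {g : Q →ₗ[Λ] R} (hfg : Function.Exact f g) :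
    Function.Exact (tensorMap N f) (tensorMap N g) := by
  obtain ⟨I, p, i, hp, hi, rfl⟩ : ∃ (I : ModuleCat.{u} Λ) (p : Q →ₗ[Λ] I) (i : I →ₗ[Λ] R),
      Function.Surjective p ∧ Function.Injective i ∧ i ∘ₗ p = g :=
    ⟨.of Λ (LinearMap.range g), g.rangeRestrict, (LinearMap.range g).subtype,
      g.surjective_rangeRestrict, Submodule.injective_subtype _, rfl⟩
  have hfp : Function.Exact f p := fun x => by
    rw [← hfg x, LinearMap.comp_apply, map_eq_zero_iff i hi]
  rw [tensorMap_comp, AddMonoidHom.coe_comp]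
  exact (exact_tensorMap_of_surjective N hfp hp).comp_injective _ (hN _ _ i hi) (map_zero _)

end Tensor

section DualHom

variable {Λ : Type u} [Ring Λ] {N : ModuleCat.{u} Λᵐᵒᵖ}

lemma sum_op_smul_coord {ι P : Type*} [Fintype ι] [AddCommGroup P] [Module Λ P]
    (b : Module.Basis ι Λ P) (φ : P →ₗ[Λ] Λ) : ∑ i, op (φ (b i)) • b.coord i = φ := by
  ext x
  conv_rhs => rw [← b.sum_repr x, map_sum]
  simp [LinearMap.sum_apply]

/-- The map `Hom(P*, N) → Hom(Q*, N)` induced by `f : P → Q`. For finite free modules this is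
`N ⊗ P → N ⊗ Q`. -/
def dualHomMap (N : ModuleCat.{u} Λᵐᵒᵖ) {P Q : Type*} [AddCommGroup P] [AddCommGroup Q]
    [Module Λ P] [Module Λ Q] (f : P →ₗ[Λ] Q) :
    ((P →ₗ[Λ] Λ) →ₗ[Λᵐᵒᵖ] N) →+ ((Q →ₗ[Λ] Λ) →ₗ[Λᵐᵒᵖ] N) :=
  (LinearMap.lcomp ℤ N (LinearMap.lcomp Λᵐᵒᵖ Λ f)).toAddMonoidHom

/-- The element `φ ↦ n φ(x)` of `Hom(P*, N)` attached to `n : N` and `x : P`. -/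
def dualHomOfPair {P : ModuleCat.{u} Λ} (n : N) (x : P) : (P →ₗ[Λ] Λ) →ₗ[Λᵐᵒᵖ] N :=
  LinearMap.toSpanSingleton Λᵐᵒᵖ N n ∘ₗ (opLinearEquiv Λᵐᵒᵖ).toLinearMap ∘ₗ evalBidual P x

/-- The canonical map `N ⊗ P → Hom(P*, N)`, which sends `n ⊗ x` to `φ ↦ n φ(x)`. -/
def tensorToHom (N : ModuleCat.{u} Λᵐᵒᵖ) (P : ModuleCat.{u} Λ) :
    ((N ⊗[ℤ] P) ⧸ tensorRel N P) →+ ((P →ₗ[Λ] Λ) →ₗ[Λᵐᵒᵖ] N) :=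
  QuotientAddGroup.lift _ (TensorProduct.lift (LinearMap.mk₂ ℤ dualHomOfPair
    (fun n n' x => by ext φ; exact smul_add (op (φ x)) n n')
    (fun z n x => by ext φ; exact smul_comm (op (φ x)) z n)
    (fun n x y => by ext φ; simp [dualHomOfPair, add_smul])
    (fun z n x => by
      ext φ
      change op (φ (z • x)) • n = z • op (φ x) • n
      rw [map_zsmul, op_smul, smul_assoc]))).toAddMonoidHom <| by
    refine (AddSubgroup.closure_le _).2 ?_
    rintro _ ⟨n, r, x, rfl⟩
    rw [SetLike.mem_coe, AddMonoidHom.mem_ker, map_sub, sub_eq_zero]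
    ext φ
    change op (φ x) • op r • n = op (φ (r • x)) • n
    rw [map_smul, smul_eq_mul, op_mul, mul_smul]

lemma tensorToHom_tensorMap {P Q : ModuleCat.{u} Λ} (f : P →ₗ[Λ] Q)
    (x : (N ⊗[ℤ] P) ⧸ tensorRel N P) :
    tensorToHom N Q (tensorMap N f x) = dualHomMap N f (tensorToHom N P x) := by
  obtain ⟨x, rfl⟩ := QuotientAddGroup.mk_surjective x
  induction x using TensorProduct.induction_on with
  | zero => simp only [QuotientAddGroup.mk_zero, map_zero]
  | tmul n y => rfl
  | add a b ha hb => simp only [QuotientAddGroup.mk_add, map_add, ha, hb]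

lemma tensorToHom_surjective (N : ModuleCat.{u} Λᵐᵒᵖ) (P : ModuleCat.{u} Λ) [Module.Free Λ P]
    [Module.Finite Λ P] : Function.Surjective (tensorToHom N P) := by
  intro v
  let b := Module.Free.chooseBasis Λ P
  refine ⟨∑ i, QuotientAddGroup.mk (v (b.coord i) ⊗ₜ[ℤ] b i), ?_⟩
  ext φ
  conv_rhs => rw [← sum_op_smul_coord b φ]
  rw [map_sum, LinearMap.sum_apply, map_sum]
  exact Finset.sum_congr rfl fun i _ => (v.map_smul _ _).symm

lemma eq_sum_tensorToHom_coord {ι : Type*} [Fintype ι] {P : ModuleCat.{u} Λ}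
    (b : Module.Basis ι Λ P) (x : (N ⊗[ℤ] P) ⧸ tensorRel N P) :
    x = ∑ i, QuotientAddGroup.mk (tensorToHom N P x (b.coord i) ⊗ₜ[ℤ] b i) := by
  obtain ⟨x, rfl⟩ := QuotientAddGroup.mk_surjective x
  induction x using TensorProduct.induction_on with
  | zero => simp
  | tmul n y =>
    conv_lhs => rw [← b.sum_repr y, TensorProduct.tmul_sum, ← QuotientAddGroup.mk'_apply, map_sum]
    refine Finset.sum_congr rfl fun i _ => Eq.symm (QuotientAddGroup.eq_iff_sub_mem.2 ?_)
    exact AddSubgroup.subset_closure ⟨n, b.repr y i, b i, rfl⟩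
  | add x y hx hy =>
    rw [QuotientAddGroup.mk_add, map_add]
    conv_lhs => rw [hx, hy, ← Finset.sum_add_distrib]
    exact Finset.sum_congr rfl fun i _ => by
      rw [LinearMap.add_apply, TensorProduct.add_tmul, QuotientAddGroup.mk_add]

lemma tensorToHom_injective (N : ModuleCat.{u} Λᵐᵒᵖ) (P : ModuleCat.{u} Λ) [Module.Free Λ P]
    [Module.Finite Λ P] : Function.Injective (tensorToHom N P) := fun x y h => by
  let b := Module.Free.chooseBasis Λ P
  rw [eq_sum_tensorToHom_coord b x, eq_sum_tensorToHom_coord b y, h]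

lemma dualHomMap_dualHomMap_eq_zero {P Q R : ModuleCat.{u} Λ} {f : P →ₗ[Λ] Q} {g : Q →ₗ[Λ] R}
    (hgf : g ∘ₗ f = 0) (v : (P →ₗ[Λ] Λ) →ₗ[Λᵐᵒᵖ] N) :
    dualHomMap N g (dualHomMap N f v) = 0 := by
  ext φ
  change v (φ ∘ₗ g ∘ₗ f) = 0
  rw [hgf, LinearMap.comp_zero, map_zero]

lemma IsFlatRight.exact_dualHomMap (hN : IsFlatRight N) {P Q R : ModuleCat.{u} Λ}
    [Module.Free Λ Q] [Module.Finite Λ Q] [Module.Free Λ R] [Module.Finite Λ R]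
    {f : P →ₗ[Λ] Q} {g : Q →ₗ[Λ] R} (hfg : Function.Exact f g) :
    Function.Exact (dualHomMap N f) (dualHomMap N g) := by
  refine fun v => ⟨fun hv => ?_, ?_⟩
  · obtain ⟨x, rfl⟩ := tensorToHom_surjective N Q v
    have hx : tensorMap N g x = 0 := tensorToHom_injective N R <| by
      rw [tensorToHom_tensorMap, hv, map_zero]
    obtain ⟨y, rfl⟩ := (hN.exact_tensorMap hfg x).1 hx
    exact ⟨tensorToHom N P y, (tensorToHom_tensorMap f y).symm⟩
  · rintro ⟨w, rfl⟩
    exact dualHomMap_dualHomMap_eq_zero hfg.linearMap_comp_eq_zero w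

/-- The segment `H_{n+1}(Hom(P*, F)) → H_{n+1}(Hom(P*, N)) → H_n(Hom(P*, K))` of the
long exact sequence. -/
lemma exact_dualHomMap_of_exact {K F N : ModuleCat.{u} Λᵐᵒᵖ} {i : K →ₗ[Λᵐᵒᵖ] F}
    {p : F →ₗ[Λᵐᵒᵖ] N} (hi : Function.Injective i) (hip : Function.Exact i p)
    (hp : Function.Surjective p) {P Q R S : ModuleCat.{u} Λ} [Module.Free Λ Q] [Module.Finite Λ Q]
    {f : P →ₗ[Λ] Q} {g : Q →ₗ[Λ] R} {h : R →ₗ[Λ] S} (hgf : g ∘ₗ f = 0) (hhg : h ∘ₗ g = 0)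
    (hF : Function.Exact (dualHomMap F f) (dualHomMap F g))
    (hK : Function.Exact (dualHomMap K g) (dualHomMap K h)) :
    Function.Exact (dualHomMap N f) (dualHomMap N g) := by
  refine fun v => ⟨fun hv => ?_, ?_⟩
  · obtain ⟨v', rfl⟩ := Module.projective_lifting_property p v hp
    obtain ⟨u, hu⟩ : ∃ u, i ∘ₗ u = dualHomMap F g v' :=
      ⟨(LinearEquiv.ofInjective i hi).symm.toLinearMap ∘ₗ (dualHomMap F g v').codRestrict
        (LinearMap.range i) fun φ => (hip _).1 congr($hv φ), LinearMap.ext fun φ => congrArg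
          Subtype.val ((LinearEquiv.ofInjective i hi).apply_symm_apply _)⟩
    have hu₀ : dualHomMap K h u = 0 := LinearMap.ext fun φ => hi <|
      congr($hu (φ ∘ₗ h)).trans <|
        congr($(dualHomMap_dualHomMap_eq_zero hhg v') φ).trans (map_zero i).symm
    obtain ⟨w, rfl⟩ := (hK u).1 hu₀
    obtain ⟨w', hw'⟩ := (hF (v' - i ∘ₗ w)).1 <| by
      rw [map_sub, ← hu]
      exact sub_self _
    refine ⟨p ∘ₗ w', ?_⟩
    change p ∘ₗ dualHomMap F f w' = p ∘ₗ v'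
    rw [hw', LinearMap.comp_sub, ← LinearMap.comp_assoc, hip.linearMap_comp_eq_zero,
      LinearMap.zero_comp, sub_zero]
  · rintro ⟨w, rfl⟩
    exact dualHomMap_dualHomMap_eq_zero hgf w

variable {M : ModuleCat.{u} Λ} (P : ProjectiveResolution M)
  [∀ n, Module.Free Λ (P.complex.X n)] [∀ n, Module.Finite Λ (P.complex.X n)]

/-- `Tor_{n+1}(N, M) = 0` for `n ≥ fd N`. -/
lemma FlatDimLE.exact_dualHomMap {m : ℕ} (hN : FlatDimLE m N) {n : ℕ} (hmn : m ≤ n) :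
    Function.Exact (dualHomMap N (P.complex.d (n + 2) (n + 1)).hom)
      (dualHomMap N (P.complex.d (n + 1) n).hom) := by
  have hd (n : ℕ) : (P.complex.d (n + 1) n).hom ∘ₗ (P.complex.d (n + 2) (n + 1)).hom = 0 :=
    congrArg ModuleCat.Hom.hom (P.complex.d_comp_d (n + 2) (n + 1) n)
  have hflat {N : ModuleCat.{u} Λᵐᵒᵖ} (hN : IsFlatRight N) (n : ℕ) :
      Function.Exact (dualHomMap N (P.complex.d (n + 2) (n + 1)).hom)
        (dualHomMap N (P.complex.d (n + 1) n).hom) :=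
    hN.exact_dualHomMap <|
      (ShortComplex.ShortExact.moduleCat_exact_iff_function_exact _).1 (P.exact_succ n)
  induction m generalizing N n with
  | zero => exact hflat hN n
  | succ m ih =>
    obtain ⟨K, F, i, p, hi, hip, hp, hF, hK⟩ := hN
    obtain ⟨n, rfl⟩ := Nat.exists_eq_add_of_le' (Nat.one_le_of_lt hmn)
    exact exact_dualHomMap_of_exact hi hip hp (hd (n + 1)) (hd n) (hflat hF (n + 1))
      (ih hK (Nat.le_of_succ_le_succ hmn))

end DualHom

section Grade

variable {Λ : Type u} [Ring Λ] {M : ModuleCat.{u} Λ}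

lemma extRing_hom_eq_zero (P : ProjectiveResolution M) {n : ℕ} (I : ModuleCat.{u} Λᵐᵒᵖ)
    [Injective I] (hI : Function.Exact (dualHomMap I (P.complex.d (n + 2) (n + 1)).hom)
      (dualHomMap I (P.complex.d (n + 1) n).hom)) (h : ExtRing M (n + 1) →ₗ[Λᵐᵒᵖ] I) : h = 0 := by
  have hI' := Module.injective_module_of_injective_object Λᵐᵒᵖ I
  obtain ⟨v, hv⟩ : ∃ v : (P.complex.X (n + 1) →ₗ[Λ] Λ) →ₗ[Λᵐᵒᵖ] I,
      ∀ f, v (Subtype.val f) = h (cocycleClass P (n + 1) f) :=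
    hI'.out (Submodule.subtype _) (Submodule.injective_subtype _) (h ∘ₗ cocycleClass P (n + 1))
  have hvd : dualHomMap I (P.complex.d (n + 1) n).hom v = 0 := by
    ext g
    have hg : g ∘ₗ (P.complex.d (n + 1) n).hom ∈
        LinearMap.ker (LinearMap.lcomp Λᵐᵒᵖ Λ (P.complex.d (n + 2) (n + 1)).hom) :=
      (congrArg (g ∘ₗ ModuleCat.Hom.hom ·) (P.complex.d_comp_d (n + 2) (n + 1) n)).trans
        (LinearMap.comp_zero g)
    exact (hv ⟨_, hg⟩).trans <|
      (congrArg h (cocycleClass_eq_zero P ⟨_, hg⟩ g rfl)).trans (map_zero h)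
  obtain ⟨w, rfl⟩ := (hI v).1 hvd
  ext z
  obtain ⟨f, rfl⟩ := cocycleClass_surjective P (n + 1) z
  exact (hv f).symm.trans <| (congrArg w f.2).trans (map_zero w)

lemma subsingleton_ext_of_forall_hom_eq_zero {R : Type u} [Ring R] {N L : ModuleCat.{u} R}
    (I : InjectiveResolution L) {n : ℕ} (h : ∀ f : N ⟶ I.cocomplex.X n, f = 0) :
    Subsingleton (Ext.{u} N L n) := subsingleton_of_forall_eq 0 fun x => by
  obtain ⟨f, hf, rfl⟩ := I.extMk_surjective x (n + 1) rfl
  obtain rfl := h f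
  exact I.extMk_zero _ _

lemma gradeGE_extRing_of_flatDimLE [IsNoetherianRing Λ] [Module.Finite Λ M]
    (I : InjectiveResolution (ModuleCat.of Λᵐᵒᵖ Λ)) {t : ℕ}
    (hI : ∀ i < t, FlatDimLE (i + 1) (I.cocomplex.X i)) :
    GradeGE t (ModuleCat.of Λᵐᵒᵖ (ExtRing M (t + 1))) := by
  obtain ⟨P, hP⟩ := exists_projectiveResolution_free M
  have (n : ℕ) := (hP n).1
  have (n : ℕ) := (hP n).2
  refine fun i hi => subsingleton_ext_of_forall_hom_eq_zero I fun f => ModuleCat.hom_ext ?_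
  exact extRing_hom_eq_zero P _ ((hI i hi).exact_dualHomMap P hi) f.hom

end Grade

end HomologicalFiniteness

open HomologicalFiniteness in
theorem proposition3p7_general (Λ : Type u) [Ring Λ] [IsNoetherianRing Λ] [IsNoetherianRing Λᵐᵒᵖ]
    (k : ℕ) :
    (∀ M : ModuleCat.{u} Λ, finMod Λ M →
      (∀ t, 1 ≤ t → t < k → GradeGE t (ModuleCat.of Λᵐᵒᵖ (ExtRing M (t + 1)))) →
      HasPropertyW Λ k → HasLeftApproximation (projDimLE Λ k) M) ∧
    (∀ I : InjectiveResolution (ModuleCat.of Λᵐᵒᵖ Λ),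
      (∀ i < k, FlatDimLE (i + 1) (I.cocomplex.X i)) →
      (HasPropertyW Λ k → IsCovariantlyFinite (projDimLE Λ k) (finMod Λ)) ∧
      (HasPropertyW Λ (k + 1) → IsCovariantlyFinite (projDimLE Λ (k + 1)) (finMod Λ))) := by
  refine ⟨fun M hM hG hΛ => ?_, fun I hI => ?_⟩
  · have : Module.Finite Λ M := hM
    exact hasLeftApproximation_of_gradeGE hΛ hG
  · have hG (M : ModuleCat.{u} Λ) (hM : finMod Λ M) (t : ℕ) (ht : t ≤ k) :
        GradeGE t (ModuleCat.of Λᵐᵒᵖ (ExtRing M (t + 1))) :=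
      have : Module.Finite Λ M := hM
      gradeGE_extRing_of_flatDimLE I fun i hi => hI i (hi.trans_le ht)
    refine ⟨fun hΛ => ⟨fun M hM => hM.1, fun M hM => ?_⟩,
      fun hΛ => ⟨fun M hM => hM.1, fun M hM => ?_⟩⟩
    all_goals
      have : Module.Finite Λ M := hM
      exact hasLeftApproximation_of_gradeGE hΛ fun t _ ht => hG M hM t (by omega)

theorem proposition3p7 (Λ : Type u) [Ring Λ] [IsNoetherianRing Λ] [IsNoetherianRing Λᵐᵒᵖ]
    (k : ℕ) (hk : 1 ≤ k) :
    (∀ M : ModuleCat.{u} Λ, HomologicalFiniteness.finMod Λ M →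
      (∀ t : ℕ, 1 ≤ t → t < k →
        HomologicalFiniteness.StrongGradeGE t
          (ModuleCat.of Λᵐᵒᵖ (HomologicalFiniteness.ExtRing M (t + 1)))) →
      HomologicalFiniteness.HasPropertyW Λ k →
      HomologicalFiniteness.HasLeftApproximation
        (HomologicalFiniteness.projDimLE Λ k) M) ∧
    (HomologicalFiniteness.IsRightQuasiGorenstein Λ k →
      (HomologicalFiniteness.HasPropertyW Λ k →
        HomologicalFiniteness.IsCovariantlyFinite
          (HomologicalFiniteness.projDimLE Λ k) (HomologicalFiniteness.finMod Λ)) ∧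
      (HomologicalFiniteness.HasPropertyW Λ (k + 1) →
        HomologicalFiniteness.IsCovariantlyFinite
          (HomologicalFiniteness.projDimLE Λ (k + 1)) (HomologicalFiniteness.finMod Λ))) :=
  ⟨fun M hM hG => (proposition3p7_general Λ k).1 M hM fun t h₁ h₂ => (hG t h₁ h₂).gradeGE,
    fun ⟨I, _, hI⟩ => (proposition3p7_general Λ k).2 I hI⟩
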